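/- A set $S\subseteq\mathbb{R}^2$ is called a $T(3,2)$-set if among any three distinct points of $S$ there are two at Euclidean distance at most $2$. Let $\delta>1$, and let $S\subseteq\mathbb{R}^2$ be a convex $T(3,2)$-set of diameter $\delta$, where the diameter of $S$ is $\sup_{p,q\in S}|p-q|$. Then the two-dimensional Lebesgue measure of $S$ satisfies \[ \lambda_2(S)\;\le\;\min\left\{\frac{\pi}{4}\cdot\frac{\delta^4}{\delta^2-1},\;2\pi\right\}. \] -/

import Mathlib

/-- A subset `S` of the Euclidean plane is a `T(a,b)`-set if among any `a` (distinct) points of `S`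
there are at least `b` whose pairwise distances are all at most `2`. -/
def IsTSet (a b : ℕ) (S : Set (EuclideanSpace ℝ (Fin 2))) : Prop :=
  ∀ P : Finset (EuclideanSpace ℝ (Fin 2)), (P : Set (EuclideanSpace ℝ (Fin 2))) ⊆ S → P.card = a →
    ∃ Q ⊆ P, b ≤ Q.card ∧ ∀ p ∈ Q, ∀ q ∈ Q, dist p q ≤ 2

/-!
The two bounds are proved separately.

The first needs no convexity. Among three points of `S` one pairwise distance is at most `2` and the
others are at most `δ`, so the three points lie in a ball whose radius `R` is the circumradius of the
isosceles triangle with sides `δ`, `δ`, `2` (`exists_dist_le_of_triangle`), and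
`R ^ 2 = δ ^ 4 / (4 * (δ ^ 2 - 1))`. The centre is the convex combination of the points whose weights
maximise the variance (`exists_mem_stdSimplex_norm_sub_sq_le`). Helly's theorem then encloses all of
`S` in one ball of radius `R` (`exists_subset_closedBall`), whose area is the claimed bound.

For the bound `2π`, pass to the closure and choose coordinates in which a diameter is the segment from
`(-k, 0)` to `(k, 0)`, with `2 * k = δ`. Let `L x` be the length of the vertical section at `x` and
`M x = L x + L (-x)`. Convexity makes `M` concave and even on `[-k, k]`, so it is antitone on `[0, k]`,
and the area `∫ x in 0..k, M x` is estimated by values of `M` at midpoints of intervals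
(`integral_symSectionLength_le`). Two constraints limit these values. The diameter gives
`M x ≤ 2 * √(4 * k ^ 2 - 4 * x ^ 2)`. If `x` and `y` exceed `2 - k`, the points of the sections at `x`
and `y` are far from `(-k, 0)`, hence within `2` of each other, which gives
`M x + M y ≤ 4 * √(4 - (x - y) ^ 2)`, and in particular `M x ≤ 4`. For small `k` the diameter
constraint at `k / 2` suffices, for medium `k` the bound `M (k / 2) ≤ 4`, and for large `k` the bound
for a pair of sections, one near `2 - k` and the other at `7 * k / 8` (`volume_le_two_pi`).
-/

open MeasureTheory

/-! ### Three points of a `T(3,2)`-set -/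

theorem IsTSet.dist_le_two {S : Set (EuclideanSpace ℝ (Fin 2))} (hT : IsTSet 3 2 S)
    {x y z : EuclideanSpace ℝ (Fin 2)} (hx : x ∈ S) (hy : y ∈ S) (hz : z ∈ S) :
    dist x y ≤ 2 ∨ dist x z ≤ 2 ∨ dist y z ≤ 2 := by
  by_contra! h
  obtain ⟨h1, h2, h3⟩ := h
  have n1 : x ≠ y := by rintro rfl; norm_num at h1
  have n2 : x ≠ z := by rintro rfl; norm_num at h2
  have n3 : y ≠ z := by rintro rfl; norm_num at h3
  obtain ⟨Q, hQ, hc, hd⟩ := hT {x, y, z} (by simp [Set.insert_subset_iff, hx, hy, hz])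
    (Finset.card_eq_three.2 ⟨x, y, z, n1, n2, n3, rfl⟩)
  obtain ⟨a, ha, b, hb, hab⟩ := Finset.one_lt_card.1 hc
  have hd := hd a ha b hb
  have ha := hQ ha
  have hb := hQ hb
  simp only [Finset.mem_insert, Finset.mem_singleton] at ha hb
  rcases ha with rfl | rfl | rfl <;> rcases hb with rfl | rfl | rfl <;>
    first
    | exact hab rfl
    | linarith
    | (rw [dist_comm] at hd; linarith)

theorem IsTSet.dist_le_two_of_mem_closure {S : Set (EuclideanSpace ℝ (Fin 2))}
    (hT : IsTSet 3 2 S) {x y z : EuclideanSpace ℝ (Fin 2)} (hx : x ∈ closure S)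
    (hy : y ∈ closure S) (hz : z ∈ closure S) :
    dist x y ≤ 2 ∨ dist x z ≤ 2 ∨ dist y z ≤ 2 := by
  let f : EuclideanSpace ℝ (Fin 2) × EuclideanSpace ℝ (Fin 2) × EuclideanSpace ℝ (Fin 2) → ℝ :=
    fun q => min (dist q.1 q.2.1) (min (dist q.1 q.2.2) (dist q.2.1 q.2.2))
  have hf : Continuous f := by fun_prop
  have hsub : closure (S ×ˢ S ×ˢ S) ⊆ f ⁻¹' Set.Iic 2 := by
    refine closure_minimal ?_ (isClosed_Iic.preimage hf)
    rintro ⟨a, b, c⟩ ⟨ha, hb, hc⟩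
    simpa only [Set.mem_preimage, Set.mem_Iic, f, min_le_iff] using hT.dist_le_two ha hb hc
  have hq : (x, y, z) ∈ closure (S ×ˢ S ×ˢ S) := by
    rw [closure_prod_eq, closure_prod_eq]
    exact ⟨hx, hy, hz⟩
  simpa only [Set.mem_preimage, Set.mem_Iic, f, min_le_iff] using hsub hq

/-! ### The enclosing ball -/

/-- Every finite family of points `p` has a convex combination `c = ∑ w j • p j` such that the squared
distance from `c` to each point is at most the `w`-weighted variance of the family. The weights are
those maximising the variance: moving `w` towards the `i`-th vertex of the simplex changes the
variance at the rate `‖p i - c‖ ^ 2` minus the variance, and this rate is nonpositive at a maximum. -/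
theorem exists_mem_stdSimplex_norm_sub_sq_le {E ι : Type*} [NormedAddCommGroup E]
    [InnerProductSpace ℝ E] [Fintype ι] [Nonempty ι] (p : ι → E) :
    ∃ w ∈ stdSimplex ℝ ι, ∀ i, ‖p i - ∑ j, w j • p j‖ ^ 2 ≤
      ∑ j, w j * ‖p j‖ ^ 2 - ‖∑ j, w j • p j‖ ^ 2 := by
  classical
  obtain ⟨w, hw, hmax⟩ := (isCompact_stdSimplex ℝ ι).exists_isMaxOn
    ⟨_, single_mem_stdSimplex ℝ (Classical.arbitrary ι)⟩
    (f := fun w : ι → ℝ => ∑ j, w j * ‖p j‖ ^ 2 - ‖∑ j, w j • p j‖ ^ 2)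
    (by fun_prop)
  refine ⟨w, hw, fun i => ?_⟩
  set c := ∑ j, w j • p j with hc
  set A := ∑ j, w j * ‖p j‖ ^ 2 with hA
  have key : ∀ t ∈ Set.Ioo (0 : ℝ) 1, (1 - t) * ‖p i - c‖ ^ 2 ≤ A - ‖c‖ ^ 2 := by
    intro t ht
    have hmem : (1 - t) • w + t • Pi.single i (1 : ℝ) ∈ stdSimplex ℝ ι :=
      convex_stdSimplex ℝ ι hw (single_mem_stdSimplex ℝ i) (by linarith [ht.2]) ht.1.le (by ring)
    have h := hmax hmem
    have h1 : ∑ j, ((1 - t) • w + t • Pi.single i (1 : ℝ) : ι → ℝ) j * ‖p j‖ ^ 2 =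
        (1 - t) * A + t * ‖p i‖ ^ 2 := by
      simp [add_mul, Finset.sum_add_distrib, mul_assoc, ← Finset.mul_sum, Pi.single_apply, hA]
    have h2 : ∑ j, ((1 - t) • w + t • Pi.single i (1 : ℝ) : ι → ℝ) j • p j =
        (1 - t) • c + t • p i := by
      simp [add_smul, Finset.sum_add_distrib, mul_smul, ← Finset.smul_sum, Pi.single_apply, hc]
    simp only [Set.mem_ofPred_eq, h1, h2] at h
    have h3 : ‖(1 - t) • c + t • p i‖ ^ 2 =
        (1 - t) ^ 2 * ‖c‖ ^ 2 + 2 * ((1 - t) * t * inner ℝ c (p i)) + t ^ 2 * ‖p i‖ ^ 2 := by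
      rw [norm_add_sq_real, norm_smul, norm_smul, real_inner_smul_left, real_inner_smul_right,
        mul_pow, mul_pow, Real.norm_eq_abs, Real.norm_eq_abs, sq_abs, sq_abs]
      ring
    rw [h3] at h
    rw [norm_sub_sq_real, real_inner_comm]
    refine le_of_mul_le_mul_left ?_ ht.1
    linarith
  have hlim : Filter.Tendsto (fun t : ℝ => (1 - t) * ‖p i - c‖ ^ 2) (nhdsWithin 0 (Set.Ioi 0))
      (nhds ((1 - 0) * ‖p i - c‖ ^ 2)) :=
    (Continuous.tendsto (by fun_prop) 0).mono_left nhdsWithin_le_nhds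
  rw [sub_zero, one_mul] at hlim
  exact le_of_tendsto hlim (Filter.mem_of_superset (Ioo_mem_nhdsGT one_pos) key)

/-- Three points with one pairwise distance at most `2` and the others at most `δ` lie in a ball whose
radius is the circumradius of the isosceles triangle with sides `δ`, `δ`, `2`. -/
theorem exists_dist_le_of_triangle {E : Type*} [NormedAddCommGroup E] [InnerProductSpace ℝ E]
    {δ : ℝ} (hδ : 1 < δ) {x y z : E} (hxy : dist x y ≤ δ) (hxz : dist x z ≤ δ)
    (hyz : dist y z ≤ 2) :
    ∃ c, ∀ u ∈ ({x, y, z} : Set E), dist u c ≤ √(δ ^ 4 / (4 * (δ ^ 2 - 1))) := by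
  obtain ⟨w, ⟨hw0, hw1⟩, h⟩ := exists_mem_stdSimplex_norm_sub_sq_le ![x, y, z]
  have hk : 0 < δ ^ 2 - 1 := by nlinarith
  suffices H : ∑ j, w j * ‖![x, y, z] j‖ ^ 2 - ‖∑ j, w j • ![x, y, z] j‖ ^ 2 ≤
      δ ^ 4 / (4 * (δ ^ 2 - 1)) by
    refine ⟨∑ j, w j • ![x, y, z] j, fun u hu => Real.le_sqrt_of_sq_le ?_⟩
    obtain ⟨i, rfl⟩ : ∃ i, ![x, y, z] i = u := by
      rcases hu with rfl | rfl | rfl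
      · exact ⟨0, rfl⟩
      · exact ⟨1, rfl⟩
      · exact ⟨2, rfl⟩
    rw [dist_eq_norm]
    exact (h i).trans H
  simp only [Fin.sum_univ_three, Matrix.cons_val_zero, Matrix.cons_val_one,
    Matrix.cons_val] at hw1 ⊢
  -- the variance is the weighted sum of the squared pairwise distances
  have e : w 0 * ‖x‖ ^ 2 + w 1 * ‖y‖ ^ 2 + w 2 * ‖z‖ ^ 2
      - ‖w 0 • x + w 1 • y + w 2 • z‖ ^ 2 =
      w 0 * w 1 * dist x y ^ 2 + w 0 * w 2 * dist x z ^ 2 + w 1 * w 2 * dist y z ^ 2 := by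
    simp only [dist_eq_norm, norm_sub_sq_real, norm_add_sq_real, norm_smul, mul_pow,
      inner_add_left, real_inner_smul_left, real_inner_smul_right, Real.norm_eq_abs, sq_abs]
    rw [show w 0 = 1 - w 1 - w 2 by linarith]
    ring
  rw [e, le_div_iff₀ (by positivity)]
  have h01 : w 0 * w 1 * dist x y ^ 2 ≤ w 0 * w 1 * δ ^ 2 := by
    gcongr; exact mul_nonneg (hw0 0) (hw0 1)
  have h02 : w 0 * w 2 * dist x z ^ 2 ≤ w 0 * w 2 * δ ^ 2 := by
    gcongr; exact mul_nonneg (hw0 0) (hw0 2)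
  have h12 : w 1 * w 2 * dist y z ^ 2 ≤ w 1 * w 2 * 2 ^ 2 := by
    gcongr; exact mul_nonneg (hw0 1) (hw0 2)
  have h3 : w 1 * w 2 * 2 ^ 2 ≤ (1 - w 0) ^ 2 := by
    rw [show w 0 = 1 - w 1 - w 2 by linarith]; nlinarith [sq_nonneg (w 1 - w 2)]
  have h4 : w 0 * w 1 * dist x y ^ 2 + w 0 * w 2 * dist x z ^ 2 + w 1 * w 2 * dist y z ^ 2 ≤
      (1 - w 0) * (1 + w 0 * (δ ^ 2 - 1)) := by
    have h5 : w 0 * w 1 * δ ^ 2 + w 0 * w 2 * δ ^ 2 = w 0 * (1 - w 0) * δ ^ 2 := by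
      rw [show w 0 = 1 - w 1 - w 2 by linarith]; ring
    linarith
  calc _ ≤ (1 - w 0) * (1 + w 0 * (δ ^ 2 - 1)) * (4 * (δ ^ 2 - 1)) := by gcongr
    _ ≤ δ ^ 4 := by
      -- the factors `(δ ^ 2 - 1) * (1 - w 0)` and `1 + w 0 * (δ ^ 2 - 1)` have sum `δ ^ 2`
      linarith [sq_nonneg ((δ ^ 2 - 1) * (1 - w 0) - (1 + w 0 * (δ ^ 2 - 1)))]

/-- By Helly's theorem, applied to the balls of the given radius centred at the points of `S`, the
enclosing ball of three points yields an enclosing ball of `S`. -/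
theorem exists_subset_closedBall
    {S : Set (EuclideanSpace ℝ (Fin 2))} {δ : ℝ} (hδ : 1 < δ) (hdist : ∀ x ∈ S, ∀ y ∈ S, dist x y ≤ δ)
    (hT : ∀ x ∈ S, ∀ y ∈ S, ∀ z ∈ S, dist x y ≤ 2 ∨ dist x z ≤ 2 ∨ dist y z ≤ 2) :
    ∃ c, S ⊆ Metric.closedBall c (√(δ ^ 4 / (4 * (δ ^ 2 - 1)))) := by
  set R := √(δ ^ 4 / (4 * (δ ^ 2 - 1)))
  have tri : ∀ x ∈ S, ∀ y ∈ S, ∀ z ∈ S, ∃ c, dist x c ≤ R ∧ dist y c ≤ R ∧ dist z c ≤ R := by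
    intro x hx y hy z hz
    rcases hT x hx y hy z hz with h | h | h
    · obtain ⟨c, hc⟩ := exists_dist_le_of_triangle hδ (hdist z hz x hx) (hdist z hz y hy) h
      exact ⟨c, hc _ (by simp), hc _ (by simp), hc _ (by simp)⟩
    · obtain ⟨c, hc⟩ := exists_dist_le_of_triangle hδ (hdist y hy x hx) (hdist y hy z hz) h
      exact ⟨c, hc _ (by simp), hc _ (by simp), hc _ (by simp)⟩
    · obtain ⟨c, hc⟩ := exists_dist_le_of_triangle hδ (hdist x hx y hy) (hdist x hx z hz) h
      exact ⟨c, hc _ (by simp), hc _ (by simp), hc _ (by simp)⟩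
  obtain ⟨c, hc⟩ := Convex.helly_theorem_compact' (𝕜 := ℝ)
    (F := fun x : S => Metric.closedBall (x : EuclideanSpace ℝ (Fin 2)) R)
    (fun _ => convex_closedBall _ _) (fun _ => isCompact_closedBall _ _) (by
      classical
      intro I hI
      rw [finrank_euclideanSpace_fin] at hI
      obtain h | h | h | h : I.card = 0 ∨ I.card = 1 ∨ I.card = 2 ∨ I.card = 3 := by omega
      · rw [Finset.card_eq_zero.1 h]
        simp
      · obtain ⟨x, rfl⟩ := Finset.card_eq_one.1 h
        obtain ⟨c, hc⟩ := tri x x.2 x x.2 x x.2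
        exact ⟨c, by simpa [dist_comm] using hc⟩
      · obtain ⟨x, y, -, rfl⟩ := Finset.card_eq_two.1 h
        obtain ⟨c, hc⟩ := tri x x.2 x x.2 y y.2
        exact ⟨c, by simpa [dist_comm] using hc⟩
      · obtain ⟨x, y, z, -, -, -, rfl⟩ := Finset.card_eq_three.1 h
        obtain ⟨c, hc⟩ := tri x x.2 y y.2 z z.2
        exact ⟨c, by simpa [dist_comm] using hc⟩)
  refine ⟨c, fun x hx => ?_⟩
  have := Set.mem_iInter.1 hc ⟨x, hx⟩
  rwa [Metric.mem_closedBall_comm]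

/-! ### Sections of planar convex sets -/

/-- The upper Hermite–Hadamard bound. The hypothesis is what concavity gives for `K` the value of `f`
at the midpoint. -/
theorem intervalIntegral_le_of_add_reflect_le {f : ℝ → ℝ} {a b K : ℝ} (hab : a ≤ b)
    (hf : IntervalIntegrable f volume a b)
    (h : ∀ x ∈ Set.Icc a b, f x + f (a + b - x) ≤ 2 * K) :
    ∫ x in a..b, f x ≤ (b - a) * K := by
  have h1 : ∫ x in a..b, f (a + b - x) = ∫ x in a..b, f x := by
    rw [intervalIntegral.integral_comp_sub_left]; simp
  have hf' : IntervalIntegrable (fun x => f (a + b - x)) volume a b := by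
    have := (hf.comp_sub_left (a + b)).symm
    simpa using this
  have h2 := intervalIntegral.integral_mono_on hab (hf.add hf')
    (intervalIntegrable_const (c := 2 * K)) h
  rw [intervalIntegral.integral_add hf hf', h1, intervalIntegral.integral_const, smul_eq_mul] at h2
  linarith

/-- The length of the vertical section of `T` at abscissa `x`; it is `0` by convention when the section
has infinite length, which does not occur for compact `T`. -/
noncomputable def sectionLength (T : Set (ℝ × ℝ)) (x : ℝ) : ℝ :=
  volume.real (Prod.mk x ⁻¹' T)

section
variable {T : Set (ℝ × ℝ)} {k : ℝ}

theorem exists_section_eq_Icc (hcomp : IsCompact T) (hconv : Convex ℝ T) {x : ℝ}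
    (hx : ∃ y, (x, y) ∈ T) :
    ∃ a b, a ≤ b ∧ Prod.mk x ⁻¹' T = Set.Icc a b := by
  have hne : (Prod.mk x ⁻¹' T).Nonempty := hx
  have hc : IsCompact (Prod.mk x ⁻¹' T) := by
    have : Prod.mk x ⁻¹' T = Prod.snd '' (T ∩ {q | q.1 = x}) := by
      ext y; simp
    rw [this]
    exact (hcomp.inter_right (isClosed_eq continuous_fst continuous_const)).image continuous_snd
  have hcv : Convex ℝ (Prod.mk x ⁻¹' T) := by
    intro y hy z hz s t hs ht hst
    have := hconv hy hz hs ht hst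
    simpa [← add_mul, hst] using this
  have := eq_Icc_of_connected_compact ⟨hne, hcv.isPreconnected⟩ hc
  refine ⟨_, _, ?_, this⟩
  rw [this] at hne
  exact Set.nonempty_Icc.1 hne

theorem sectionLength_add_le (hcomp : IsCompact T) (hconv : Convex ℝ T) {x y D : ℝ}
    (hx : ∃ s, (x, s) ∈ T) (hy : ∃ s, (y, s) ∈ T) (hD : 0 ≤ D)
    (h : ∀ s t, (x, s) ∈ T → (y, t) ∈ T → (s - t) ^ 2 ≤ D ^ 2) :
    sectionLength T x + sectionLength T y ≤ 2 * D := by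
  obtain ⟨a, b, hab, e⟩ := exists_section_eq_Icc hcomp hconv hx
  obtain ⟨a', b', hab', e'⟩ := exists_section_eq_Icc hcomp hconv hy
  rw [sectionLength, sectionLength, e, e', Real.volume_real_Icc_of_le hab,
    Real.volume_real_Icc_of_le hab']
  have m : ∀ s ∈ Set.Icc a b, (x, s) ∈ T := fun s hs => by rw [← e] at hs; exact hs
  have m' : ∀ s ∈ Set.Icc a' b', (y, s) ∈ T := fun s hs => by rw [← e'] at hs; exact hs
  have h1 := (abs_le_of_sq_le_sq' (h b a' (m _ (by simpa)) (m' _ (by simpa))) hD).2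
  have h2 := (abs_le_of_sq_le_sq' (h a b' (m _ (by simpa)) (m' _ (by simpa))) hD).1
  linarith

/-- The one-dimensional Brunn–Minkowski inequality for the sections of a convex set. -/
theorem concaveOn_sectionLength (hcomp : IsCompact T) (hconv : Convex ℝ T) {I : Set ℝ}
    (hI : Convex ℝ I) (hne : ∀ x ∈ I, ∃ s, (x, s) ∈ T) :
    ConcaveOn ℝ I (sectionLength T) := by
  refine ⟨hI, fun x hx y hy s t hs ht hst => ?_⟩
  obtain ⟨a, b, hab, e⟩ := exists_section_eq_Icc hcomp hconv (hne x hx)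
  obtain ⟨a', b', hab', e'⟩ := exists_section_eq_Icc hcomp hconv (hne y hy)
  obtain ⟨a'', b'', hab'', e''⟩ := exists_section_eq_Icc hcomp hconv
    (hne _ (hI hx hy hs ht hst))
  rw [sectionLength, sectionLength, sectionLength, e, e', e'', Real.volume_real_Icc_of_le hab,
    Real.volume_real_Icc_of_le hab', Real.volume_real_Icc_of_le hab'']
  have m : ∀ u ∈ Set.Icc a b, (x, u) ∈ T := fun u hu => by rw [← e] at hu; exact hu
  have m' : ∀ u ∈ Set.Icc a' b', (y, u) ∈ T := fun u hu => by rw [← e'] at hu; exact hu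
  have h1 : s * a + t * a' ∈ Set.Icc a'' b'' := by
    rw [← e'']
    exact hconv (m a (by simpa)) (m' a' (by simpa)) hs ht hst
  have h2 : s * b + t * b' ∈ Set.Icc a'' b'' := by
    rw [← e'']
    exact hconv (m b (by simpa)) (m' b' (by simpa)) hs ht hst
  simp only [smul_eq_mul]
  linarith [h1.1, h2.2]

/-- Cavalieri's principle. -/
theorem volume_eq_integral_sectionLength (hcomp : IsCompact T) (hk : 0 ≤ k)
    (hT : ∀ q ∈ T, q.1 ∈ Set.Icc (-k) k) :
    IntervalIntegrable (sectionLength T) volume (-k) k ∧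
    volume T = ENNReal.ofReal (∫ x in (-k)..k, sectionLength T x) := by
  have hint : Integrable (fun x => volume.real (Prod.mk x ⁻¹' T)) volume :=
    Measure.integrable_measure_prodMk_left (μ := volume) (ν := volume) hcomp.measurableSet
      hcomp.measure_lt_top.ne
  refine ⟨hint.intervalIntegrable, ?_⟩
  have h1 : ∫ x, sectionLength T x = volume.real T := by
    have hfin : ∀ᵐ x : ℝ, volume (Prod.mk x ⁻¹' T) < ⊤ :=
      Measure.ae_measure_lt_top hcomp.measurableSet (by
        rw [← Measure.volume_eq_prod]; exact hcomp.measure_lt_top.ne)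
    rw [Measure.real, Measure.volume_eq_prod, Measure.prod_apply hcomp.measurableSet]
    exact integral_toReal (measurable_measure_prodMk_left hcomp.measurableSet).aemeasurable hfin
  rw [intervalIntegral.integral_of_le (by linarith), ← integral_Icc_eq_integral_Ioc,
    setIntegral_eq_integral_of_forall_compl_eq_zero, h1, ofReal_measureReal hcomp.measure_lt_top.ne]
  intro x hx
  have : Prod.mk x ⁻¹' T = ∅ := by
    ext y
    simp only [Set.mem_preimage, Set.mem_empty_iff_false, iff_false]
    exact fun h => hx (hT _ h)
  simp [sectionLength, this]

/-- The sum of the lengths of the vertical sections of `T` at `x` and `-x`: twice the even part of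
`sectionLength T`. -/
noncomputable def symSectionLength (T : Set (ℝ × ℝ)) (x : ℝ) : ℝ :=
  sectionLength T x + sectionLength T (-x)

theorem concaveOn_symSectionLength (h : ConcaveOn ℝ (Set.Icc (-k) k) (sectionLength T)) :
    ConcaveOn ℝ (Set.Icc (-k) k) (symSectionLength T) := by
  refine h.add ⟨convex_Icc _ _, fun x hx y hy s t hs ht hst => ?_⟩
  have hneg : ∀ z ∈ Set.Icc (-k) k, -z ∈ Set.Icc (-k) k := fun z hz =>
    ⟨by linarith [hz.2], by linarith [hz.1]⟩
  have := h.2 (hneg x hx) (hneg y hy) hs ht hst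
  simpa only [smul_neg, neg_add] using this

theorem symSectionLength_le_of_abs_le (h : ConcaveOn ℝ (Set.Icc (-k) k) (sectionLength T))
    {a b : ℝ} (hab : |a| ≤ b) (hb : b ≤ k) : symSectionLength T b ≤ symSectionLength T a := by
  have h0 : 0 ≤ b := (abs_nonneg a).trans hab
  rcases h0.eq_or_lt with rfl | h0
  · rw [abs_nonpos_iff.1 hab]
  obtain ⟨h1, h2⟩ := abs_le.1 hab
  have := (concaveOn_symSectionLength h).2
    (show b ∈ Set.Icc (-k) k from ⟨by linarith, hb⟩)
    (show -b ∈ Set.Icc (-k) k from ⟨by linarith, by linarith⟩)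
    (show 0 ≤ (b + a) / (2 * b) from div_nonneg (by linarith) (by linarith))
    (show 0 ≤ (b - a) / (2 * b) from div_nonneg (by linarith) (by linarith))
    (by field_simp; ring)
  have e : symSectionLength T (-b) = symSectionLength T b := by
    simp [symSectionLength, add_comm]
  simp only [smul_eq_mul] at this
  rw [e, ← add_mul] at this
  have e1 : (b + a) / (2 * b) + (b - a) / (2 * b) = 1 := by field_simp; ring
  have e2 : (b + a) / (2 * b) * b + (b - a) / (2 * b) * -b = a := by field_simp; ring
  rwa [e1, e2, one_mul] at this

theorem integral_symSectionLength_le (h : ConcaveOn ℝ (Set.Icc (-k) k) (sectionLength T))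
    {a b : ℝ} (ha : -k ≤ a) (hab : a ≤ b) (hb : b ≤ k)
    (hi : IntervalIntegrable (symSectionLength T) volume a b) :
    ∫ x in a..b, symSectionLength T x ≤ (b - a) * symSectionLength T ((a + b) / 2) := by
  refine intervalIntegral_le_of_add_reflect_le hab hi fun x hx => ?_
  have := (concaveOn_symSectionLength h).2
    (show x ∈ Set.Icc (-k) k from ⟨by linarith [hx.1], by linarith [hx.2]⟩)
    (show a + b - x ∈ Set.Icc (-k) k from ⟨by linarith [hx.2], by linarith [hx.1]⟩)
    (show (0 : ℝ) ≤ 1 / 2 by norm_num) (show (0 : ℝ) ≤ 1 / 2 by norm_num) (by norm_num)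
  simp only [smul_eq_mul] at this
  rw [show 1 / 2 * x + 1 / 2 * (a + b - x) = (a + b) / 2 by ring] at this
  linarith

theorem volume_eq_integral_symSectionLength (hcomp : IsCompact T) (hk : 0 ≤ k)
    (hT : ∀ q ∈ T, q.1 ∈ Set.Icc (-k) k) :
    (∀ a b, 0 ≤ a → a ≤ b → b ≤ k → IntervalIntegrable (symSectionLength T) volume a b) ∧
    volume T = ENNReal.ofReal (∫ x in 0..k, symSectionLength T x) := by
  obtain ⟨hi, hv⟩ := volume_eq_integral_sectionLength hcomp hk hT
  have hi1 : IntervalIntegrable (sectionLength T) volume (-k) 0 :=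
    hi.mono_set (by rw [Set.uIcc_of_le (by linarith), Set.uIcc_of_le (by linarith)]
                    exact Set.Icc_subset_Icc le_rfl hk)
  have hi2 : IntervalIntegrable (sectionLength T) volume 0 k :=
    hi.mono_set (by rw [Set.uIcc_of_le (by linarith), Set.uIcc_of_le (by linarith)]
                    exact Set.Icc_subset_Icc (by linarith) le_rfl)
  have hi3 : IntervalIntegrable (fun x => sectionLength T (-x)) volume 0 k := by
    simpa using hi1.symm.comp_sub_left 0
  refine ⟨fun a b ha hab hb => (hi2.add hi3).mono_set ?_, ?_⟩
  · rw [Set.uIcc_of_le hab, Set.uIcc_of_le hk]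
    exact Set.Icc_subset_Icc ha hb
  · have : ∫ x in 0..k, symSectionLength T x =
        (∫ x in 0..k, sectionLength T x) + ∫ x in 0..k, sectionLength T (-x) :=
      intervalIntegral.integral_add hi2 hi3
    rw [hv, this, intervalIntegral.integral_comp_neg, neg_zero, add_comm,
      intervalIntegral.integral_add_adjacent_intervals hi1 hi2]

end

/-! ### The bound `2π` -/

theorem add_mul_sqrt_le_pi {k : ℝ} (h1 : 3 / 2 ≤ k) (h2 : k ≤ 2) :
    k + k / 2 * √(4 - (15 * k / 8 - 201 / 100) ^ 2) ≤ Real.pi := by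
  have hX : 0 ≤ 4 - (15 * k / 8 - 201 / 100) ^ 2 := by nlinarith
  -- the left side of the goal is largest near `k = 1.82`, where the square root is about `1.41`;
  -- the square root is replaced by its tangent there
  have hs : √(4 - (15 * k / 8 - 201 / 100) ^ 2) ≤
      (4 - (15 * k / 8 - 201 / 100) ^ 2 + (141 / 100) ^ 2) / (2 * (141 / 100)) := by
    rw [le_div_iff₀ (by norm_num)]
    nlinarith [sq_nonneg (√(4 - (15 * k / 8 - 201 / 100) ^ 2) - (141 / 100)), Real.sq_sqrt hX]
  have hle : k + k / 2 *
      ((4 - (15 * k / 8 - 201 / 100) ^ 2 + (141 / 100) ^ 2) / (2 * (141 / 100))) ≤ 3.14 := by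
    -- the difference is a cubic in `k` with its local minimum near `228 / 125`
    have e := mul_nonneg (by linarith : (0 : ℝ) ≤ k + 3 / 2) (sq_nonneg (k - 228 / 125))
    rw [← sub_nonneg]
    ring_nf at e ⊢
    nlinarith only [sq_nonneg k, e, h2]
  have := mul_le_mul_of_nonneg_left hs (by linarith : 0 ≤ k / 2)
  linarith [Real.pi_gt_d2]

/-- The bound `2π` in coordinates where a diameter of `T` is the segment from `(-k, 0)` to `(k, 0)`. -/
theorem volume_le_two_pi {T : Set (ℝ × ℝ)} {k : ℝ} (hcomp : IsCompact T) (hconv : Convex ℝ T)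
    (hk : 0 < k)
    (hp : (-k, 0) ∈ T) (hq : (k, 0) ∈ T)
    (hdist : ∀ u ∈ T, ∀ v ∈ T, (u.1 - v.1) ^ 2 + (u.2 - v.2) ^ 2 ≤ (2 * k) ^ 2)
    (hT : ∀ u ∈ T, ∀ v ∈ T, ∀ w ∈ T, (u.1 - v.1) ^ 2 + (u.2 - v.2) ^ 2 ≤ 2 ^ 2 ∨
      (u.1 - w.1) ^ 2 + (u.2 - w.2) ^ 2 ≤ 2 ^ 2 ∨ (v.1 - w.1) ^ 2 + (v.2 - w.2) ^ 2 ≤ 2 ^ 2) :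
    volume T ≤ ENNReal.ofReal (2 * Real.pi) := by
  have hmem : ∀ x ∈ Set.Icc (-k) k, ∃ s, (x, s) ∈ T := by
    intro x hx
    refine ⟨0, ?_⟩
    have := hconv hp hq (a := (k - x) / (2 * k)) (b := (k + x) / (2 * k))
      (div_nonneg (by linarith [hx.2]) (by linarith))
      (div_nonneg (by linarith [hx.1]) (by linarith)) (by field_simp; ring)
    convert this using 1
    ext
    · simp; field_simp; ring
    · simp
  have hstrip : ∀ q ∈ T, q.1 ∈ Set.Icc (-k) k := by
    intro q hq'
    have h1 := hdist _ hq' _ hp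
    have h2 := hdist _ hq' _ hq
    simp only at h1 h2
    constructor <;> nlinarith [sq_nonneg q.2]
  have hk2 : k ≤ 2 := by
    have h0 : ((0 : ℝ), (0 : ℝ)) ∈ T := by
      have := hconv hp hq (a := 1 / 2) (b := 1 / 2) (by norm_num) (by norm_num) (by norm_num)
      simpa using this
    rcases hT _ hp _ h0 _ hq with h | h | h <;> simp only at h <;> nlinarith
  have hconc := concaveOn_sectionLength hcomp hconv (convex_Icc (-k) k) hmem
  obtain ⟨hint, hvol⟩ := volume_eq_integral_symSectionLength hcomp hk.le hstrip
  -- two points on the same side of the middle strip `|x| ≤ 2 - k` are far from the opposite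
  -- endpoint of the diameter, hence at distance at most `2` from each other
  have hpair : ∀ x y D, 2 - k < x → x ≤ k → 2 - k < y → y ≤ k → 0 ≤ D → 4 - (x - y) ^ 2 ≤ D ^ 2 →
      symSectionLength T x + symSectionLength T y ≤ 4 * D := by
    intro x y D hx hxk hy hyk hD h
    have h1 : sectionLength T x + sectionLength T y ≤ 2 * D := by
      refine sectionLength_add_le hcomp hconv (hmem x ⟨by linarith, hxk⟩)
        (hmem y ⟨by linarith, hyk⟩) hD fun s t hs ht => ?_
      rcases hT _ hp _ hs _ ht with h' | h' | h' <;> simp only at h' <;>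
        nlinarith [sq_nonneg s, sq_nonneg t]
    have h2 : sectionLength T (-x) + sectionLength T (-y) ≤ 2 * D := by
      refine sectionLength_add_le hcomp hconv (hmem (-x) ⟨by linarith, by linarith⟩)
        (hmem (-y) ⟨by linarith, by linarith⟩) hD fun s t hs ht => ?_
      rcases hT _ hq _ hs _ ht with h' | h' | h' <;> simp only at h' <;>
        nlinarith [sq_nonneg s, sq_nonneg t]
    simp only [symSectionLength]
    linarith
  have hle4 : ∀ x, 2 - k < x → x ≤ k → symSectionLength T x ≤ 4 := fun x hx hxk => by
    have := hpair x x 2 hx hxk hx hxk (by norm_num) (by norm_num)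
    linarith
  rw [hvol]
  refine ENNReal.ofReal_le_ofReal ?_
  have hpi := Real.pi_gt_d2
  have hmid := integral_symSectionLength_le hconc (by linarith) hk.le le_rfl
    (hint 0 k le_rfl hk.le le_rfl)
  rw [sub_zero, zero_add] at hmid
  rcases le_or_gt k 1.34 with h1 | h1
  -- short diameter: sections at `±k / 2` are bounded by the diameter alone; the threshold only has to
  -- satisfy `4 / 3 < 1.34` and `√3 * 1.34 ^ 2 ≤ π`
  · have h2 : symSectionLength T (k / 2) ≤ 2 * (√3 * k) := by
      refine sectionLength_add_le hcomp hconv (hmem _ ⟨by linarith, by linarith⟩)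
        (hmem _ ⟨by linarith, by linarith⟩) (by positivity) fun s t hs ht => ?_
      have := hdist _ hs _ ht
      simp only at this
      rw [mul_pow, Real.sq_sqrt (by norm_num)]
      nlinarith
    have h3 : √3 ≤ 1.733 := Real.sqrt_le_iff.2 (by norm_num)
    calc _ ≤ k * (2 * (√3 * k)) := hmid.trans (by gcongr)
      _ = 2 * (√3 * k ^ 2) := by ring
      _ ≤ 2 * (1.733 * 1.34 ^ 2) := by gcongr
      _ ≤ _ := by norm_num at hpi ⊢; linarith
  -- medium diameter: `k / 2` lies outside the middle strip
  rcases le_or_gt k (3 / 2) with h2 | h2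
  · have := hle4 (k / 2) (by linarith) (by linarith)
    nlinarith
  -- long diameter: with `M` the symmetrised section length, `m = M (2.01 - k)` and `D` the bound for
  -- pairs at `2.01 - k` and `7 * k / 8`, the midpoint bounds on `[0, 3 * k / 4]` and `[3 * k / 4, k]`
  -- give `3 * k / 4 * m + k / 4 * (4 * D - m) ≤ 2 * k + k * D`; `2.01` instead of `2` makes
  -- `2.01 - k` lie strictly outside the middle strip
  have hI := intervalIntegral.integral_add_adjacent_intervals
    (hint 0 (3 * k / 4) le_rfl (by linarith) (by linarith))
    (hint (3 * k / 4) k (by linarith) (by linarith) le_rfl)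
  have hI1 := integral_symSectionLength_le hconc (by linarith) (by linarith) (by linarith)
    (hint 0 (3 * k / 4) le_rfl (by linarith) (by linarith))
  have hI2 := integral_symSectionLength_le hconc (by linarith) (by linarith) le_rfl
    (hint (3 * k / 4) k (by linarith) (by linarith) le_rfl)
  rw [show (0 + 3 * k / 4) / 2 = 3 * k / 8 by ring] at hI1
  rw [show (3 * k / 4 + k) / 2 = 7 * k / 8 by ring] at hI2
  have hm := symSectionLength_le_of_abs_le hconc (a := 201 / 100 - k) (b := 3 * k / 8)
    (abs_le.2 ⟨by linarith, by linarith⟩) (by linarith)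
  have hm4 := hle4 (201 / 100 - k) (by linarith) (by linarith)
  have hp2 := hpair (201 / 100 - k) (7 * k / 8) (√(4 - (15 * k / 8 - 201 / 100) ^ 2))
    (by linarith) (by linarith) (by linarith) (by linarith) (Real.sqrt_nonneg _)
    (by rw [Real.sq_sqrt (by nlinarith)]; apply le_of_eq; ring)
  have hnum := add_mul_sqrt_le_pi h2.le hk2
  rw [← hI]
  set D := √(4 - (15 * k / 8 - 201 / 100) ^ 2)
  nlinarith

/-- Orthonormal affine coordinates with origin at the midpoint of `p` and `q` and first axis along
`q - p`. The source is `ℝ × ℝ` with its product measure; as its metric is the sup metric, the isometry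
property is stated through squared distances. -/
theorem exists_measurePreserving_prod {p q : EuclideanSpace ℝ (Fin 2)} (hpq : p ≠ q) :
    ∃ ψ : ℝ × ℝ →ᵃ[ℝ] EuclideanSpace ℝ (Fin 2), MeasurePreserving ψ volume volume ∧
      (∀ u v, dist (ψ u) (ψ v) ^ 2 = (u.1 - v.1) ^ 2 + (u.2 - v.2) ^ 2) ∧
      ψ (-(dist p q / 2), 0) = p ∧ ψ (dist p q / 2, 0) = q := by
  have hd : 0 < dist p q := dist_pos.2 hpq
  obtain ⟨b, hb⟩ := Orthonormal.exists_orthonormalBasis_extension_of_card_eq (𝕜 := ℝ)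
    (E := EuclideanSpace ℝ (Fin 2)) (ι := Fin 2) (by simp)
    (v := fun _ => (dist p q)⁻¹ • (q - p)) (s := {0}) (by
      constructor
      · intro i
        simp only [Set.domRestrict_apply]
        rw [norm_smul, ← dist_eq_norm, dist_comm q p, norm_inv, Real.norm_eq_abs, abs_of_pos hd,
          inv_mul_cancel₀ hd.ne']
      · intro i j hij
        exact absurd (Subsingleton.elim i j) hij)
  have hb0 : b 0 = (dist p q)⁻¹ • (q - p) := hb 0 rfl
  let m : EuclideanSpace ℝ (Fin 2) := (1 / 2 : ℝ) • (p + q)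
  let l : ℝ × ℝ →ₗ[ℝ] EuclideanSpace ℝ (Fin 2) :=
    (LinearMap.fst ℝ ℝ ℝ).smulRight (b 0) + (LinearMap.snd ℝ ℝ ℝ).smulRight (b 1)
  have hl : ∀ u, l u = u.1 • b 0 + u.2 • b 1 := fun u => rfl
  have hl' : ∀ u, l u = b.repr.symm (WithLp.toLp 2 (MeasurableEquiv.finTwoArrow.symm u)) := by
    intro u
    rw [hl, ← b.sum_repr_symm]
    simp [Fin.sum_univ_two, MeasurableEquiv.finTwoArrow]
  refine ⟨(AffineEquiv.vaddConst ℝ m).toAffineMap.comp l.toAffineMap, ?_, ?_, ?_, ?_⟩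
  · have h1 : MeasurePreserving l volume volume := by
      have := (b.measurePreserving_repr_symm.comp (PiLp.volume_preserving_toLp (Fin 2))).comp
        (volume_preserving_finTwoArrow ℝ).symm
      convert this using 1
      ext1 u
      exact hl' u
    exact (measurePreserving_add_right volume m).comp h1
  · intro u v
    have : dist (l u + m) (l v + m) ^ 2 = (u.1 - v.1) ^ 2 + (u.2 - v.2) ^ 2 := by
      rw [dist_add_right, hl', hl', LinearIsometryEquiv.dist_map, EuclideanSpace.dist_eq,
        Real.sq_sqrt (by positivity)]
      simp [Fin.sum_univ_two, MeasurableEquiv.finTwoArrow, Real.dist_eq, sq_abs]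
    exact this
  · have : l (-(dist p q / 2), 0) + m = p := by
      simp only [hl, hb0, zero_smul, add_zero, smul_smul, m]
      rw [show -(dist p q / 2) * (dist p q)⁻¹ = -(1 / 2) by field_simp]
      module
    exact this
  · have : l (dist p q / 2, 0) + m = q := by
      simp only [hl, hb0, zero_smul, add_zero, smul_smul, m]
      rw [show (dist p q / 2) * (dist p q)⁻¹ = 1 / 2 by field_simp]
      module
    exact this

theorem exists_dist_eq_diam {E : Type*} [PseudoMetricSpace E] {K : Set E} (hK : IsCompact K)
    (hne : K.Nonempty) :
    ∃ p ∈ K, ∃ q ∈ K, dist p q = Metric.diam K := by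
  obtain ⟨⟨p, q⟩, ⟨hp, hq⟩, hmax⟩ := (hK.prod hK).exists_isMaxOn (hne.prod hne)
    (f := fun u : E × E => dist u.1 u.2) (by fun_prop)
  refine ⟨p, hp, q, hq, le_antisymm (Metric.dist_le_diam_of_mem hK.isBounded hp hq) ?_⟩
  exact Metric.diam_le_of_forall_dist_le dist_nonneg fun x hx y hy =>
    hmax (⟨hx, hy⟩ : (x, y) ∈ K ×ˢ K)

theorem volume_le_two_pi_of_compact {K : Set (EuclideanSpace ℝ (Fin 2))} (hK : IsCompact K)
    (hconv : Convex ℝ K) (hdiam : 0 < Metric.diam K)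
    (hT : ∀ x ∈ K, ∀ y ∈ K, ∀ z ∈ K, dist x y ≤ 2 ∨ dist x z ≤ 2 ∨ dist y z ≤ 2) :
    volume K ≤ ENNReal.ofReal (2 * Real.pi) := by
  have hne : K.Nonempty := by
    rw [Set.nonempty_iff_ne_empty]
    rintro rfl
    simp at hdiam
  obtain ⟨p, hp, q, hq, hpq⟩ := exists_dist_eq_diam hK hne
  obtain ⟨ψ, hψ, hψd, hψp, hψq⟩ := exists_measurePreserving_prod (dist_pos.1 (hpq ▸ hdiam))
  have hle : ∀ u v c, 0 ≤ c → dist (ψ u) (ψ v) ≤ c →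
      (u.1 - v.1) ^ 2 + (u.2 - v.2) ^ 2 ≤ c ^ 2 := fun u v c _ h => by
    rw [← hψd]; gcongr
  have hcont : Continuous ψ := ψ.continuous_of_finiteDimensional
  have hcomp : IsCompact (ψ ⁻¹' K) := by
    refine Metric.isCompact_of_isClosed_isBounded (hK.isClosed.preimage hcont)
      (Metric.isBounded_iff.2 ⟨Metric.diam K, fun u hu v hv => ?_⟩)
    have h1 := hle u v _ hdiam.le (Metric.dist_le_diam_of_mem hK.isBounded hu hv)
    rw [Prod.dist_eq, Real.dist_eq, Real.dist_eq]
    exact max_le (abs_le_of_sq_le_sq (by nlinarith) hdiam.le)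
      (abs_le_of_sq_le_sq (by nlinarith) hdiam.le)
  rw [← hψ.measure_preimage hK.measurableSet.nullMeasurableSet]
  refine volume_le_two_pi (k := dist p q / 2) hcomp (hconv.affine_preimage ψ) (by linarith)
    (by rw [Set.mem_preimage, hψp]; exact hp) (by rw [Set.mem_preimage, hψq]; exact hq)
    (fun u hu v hv => hle u v _ (by positivity) ?_) fun u hu v hv w hw => ?_
  · rw [mul_div_cancel₀ _ two_ne_zero, hpq]
    exact Metric.dist_le_diam_of_mem hK.isBounded hu hv
  · exact (hT _ hu _ hv _ hw).imp (hle _ _ _ zero_le_two)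
      (Or.imp (hle _ _ _ zero_le_two) (hle _ _ _ zero_le_two))

/-! ### The area of a `T(3,2)`-set -/

theorem mainTheorem5 (S : Set (EuclideanSpace ℝ (Fin 2))) (δ : ℝ) (hδ : 1 < δ)
    (hconv : Convex ℝ S) (hT : IsTSet 3 2 S) (hdiam : Metric.diam S = δ) :
    MeasureTheory.volume S ≤
      ENNReal.ofReal (min (Real.pi / 4 * (δ ^ 4 / (δ ^ 2 - 1))) (2 * Real.pi)) := by
  have hT' : ∀ x ∈ closure S, ∀ y ∈ closure S, ∀ z ∈ closure S,
      dist x y ≤ 2 ∨ dist x z ≤ 2 ∨ dist y z ≤ 2 :=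
    fun x hx y hy z hz => hT.dist_le_two_of_mem_closure hx hy hz
  -- the diameter of an unbounded set is `0` by convention
  have hbdd : Bornology.IsBounded S := by
    by_contra h
    rw [Metric.diam_eq_zero_of_unbounded h] at hdiam
    linarith
  have hk : 0 < δ ^ 2 - 1 := by nlinarith
  rw [ENNReal.ofReal_min]
  refine le_min ?_ ?_
  · obtain ⟨c, hc⟩ := exists_subset_closedBall hδ
      (fun x hx y hy => hdiam ▸ Metric.dist_le_diam_of_mem hbdd hx hy)
      (fun x hx y hy z hz =>
        hT' x (subset_closure hx) y (subset_closure hy) z (subset_closure hz))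
    refine (measure_mono hc).trans (le_of_eq ?_)
    rw [EuclideanSpace.volume_closedBall_fin_two, ← ENNReal.ofReal_pow (Real.sqrt_nonneg _),
      Real.sq_sqrt (by positivity), ← ENNReal.ofReal_mul (by positivity)]
    congr 1
    field_simp
  · refine (measure_mono subset_closure).trans
      (volume_le_two_pi_of_compact hbdd.isCompact_closure hconv.closure ?_ hT')
    rw [Metric.diam_closure, hdiam]
    linarith
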